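/- Let $n \ge 0$ and let $a_1,\dots,a_n,b_1,\dots,b_n$ be positive integers. Grade the polynomial ring $R=\mathbb{C}[x_1,\dots,x_n]$ by $\deg x_i=b_i$, and let $\mathbb{P}(b_1,\dots,b_n)=\operatorname{Proj} R$. The following are equivalent: 1. There exists a regular sequence $f_1,\dots,f_n$ of nonzero homogeneous elements of $R$ with $\deg f_i=a_i$ for all $i$ (regular sequence: $f_i$ is not a zero-divisor on $R/(f_1,\dots,f_{i-1})$ for every $i$, and $(f_1,\dots,f_n)\neq R$). 2. There exists an empty weighted complete intersection $X_{a_1,\dots,a_n}\subset\mathbb{P}(b_1,\dots,b_n)$, i.e. there exists a regular sequence as in 1 whose vanishing set $V(f_1,\dots,f_n)$ in $\mathbb{P}(b_1,\dots,b_n)$ is empty. 3. For every subset $I\subseteq\{1,\dots,n\}$, $$\#\{\,j\in\{1,\dots,n\} : a_j\in\langle b_i : i\in I\rangle\,\}\ \ge\ \#I ,$$ where $\langle b_i : i\in I\rangle=\{\sum_{i\in I}c_ib_i : c_i\in\mathbb{Z}_{\ge 0}\}$ is the numerical semigroup generated by the $b_i$ with $i\in I$ (so that it contains $0$, and equals $\{0\}$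 for $I=\emptyset$). -/

import Mathlib

/-- The polynomial ring `ℂ[x₁, …, xₙ]` graded by `deg xᵢ = bᵢ`: the family of its homogeneous
components. -/
noncomputable abbrev weightedGrading {n : ℕ} (b : Fin n → ℕ) :
    ℕ → Submodule ℂ (MvPolynomial (Fin n) ℂ) :=
  MvPolynomial.weightedHomogeneousSubmodule ℂ b

/-- `f₁, …, fₘ` is a regular sequence of nonzero homogeneous elements with `deg fᵢ = aᵢ` in
`ℂ[x₁, …, xₙ]`, where `deg xᵢ = bᵢ`. -/
structure IsHomogeneousRegularSequence {m n : ℕ} (a : Fin m → ℕ) (b : Fin n → ℕ)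
    (f : Fin m → MvPolynomial (Fin n) ℂ) : Prop where
  ne_zero : ∀ i, f i ≠ 0
  homogeneous : ∀ i, MvPolynomial.IsWeightedHomogeneous b (f i) (a i)
  regular : RingTheory.Sequence.IsRegular (MvPolynomial (Fin n) ℂ) (List.ofFn f)

noncomputable instance weightedGrading.gradedAlgebra {n : ℕ} (b : Fin n → ℕ) :
    GradedAlgebra (weightedGrading b) :=
  MvPolynomial.weightedGradedAlgebra ℂ b

/-- The weighted projective space `ℙ(b₁, …, bₙ) = Proj ℂ[x₁, …, xₙ]`, where `deg xᵢ = bᵢ`. -/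
abbrev WeightedProjectiveSpace {n : ℕ} (b : Fin n → ℕ) : Type :=
  ProjectiveSpectrum (weightedGrading b)

/-- `X ⊆ ℙ(b₁, …, bₙ)` is a weighted complete intersection of degrees `a₁, …, aₘ`: the vanishing
set of a regular sequence of homogeneous elements of these degrees. -/
def IsWeightedCompleteIntersection {m n : ℕ} (a : Fin m → ℕ) (b : Fin n → ℕ)
    (X : Set (WeightedProjectiveSpace b)) : Prop :=
  ∃ f : Fin m → MvPolynomial (Fin n) ℂ,
    IsHomogeneousRegularSequence a b f ∧
      X = ProjectiveSpectrum.zeroLocus (weightedGrading b) (Set.range f)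

/-- The numerical semigroup generated by a set `S` of positive integers: all linear combinations
of elements of `S` with nonnegative integer coefficients (so `0` belongs to it). -/
abbrev numericalSemigroup (S : Set ℕ) : AddSubmonoid ℕ :=
  AddSubmonoid.closure S

/-! Everything is read off heights of primes. Let m be the ideal of all variables, of height at most
n.

A prime containing a regular sequence of length n has height at least n, while a homogeneous prime
lies in m. So a point of Proj on which all f_j vanish would be m itself, which contains the
irrelevant ideal: 1 gives 2.

For 1 to 3, set the variables outside I to zero. Every f_j whose degree is not in the semigroup of I
then vanishes, so all the f_j lie in an ideal with n - #I + #J generators, J being the indices of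
the other degrees. Krull's height theorem bounds a minimal prime of it by that number, and
regularity by n from below (`card_le_card_filter_mem_closure`).

For 3 to 1, choose general forms one at a time. Every prime P containing them has height at least
the number of variables in P plus the number of degrees in the semigroup of the variables outside P
(`exists_isWeightedHomogeneous_card_le_height`); by 3 this is at least n. The forms are thus a
system of parameters in the Cohen-Macaulay localization at m, hence regular there, and homogeneity
brings this back to the polynomial ring (`isWeaklyRegular_of_forall_le_height`). -/

/-! ### Depth, dimension and systems of parameters over Noetherian local rings -/

namespace IsLocalRing

open Module RingTheory.Sequence Pointwise

variable {R : Type*} [CommRing R] [IsNoetherianRing R] [IsLocalRing R]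

/-- An associated prime of a module of depth at least `r` has coheight at least `r`. -/
theorem length_le_ringKrullDim_quotient_of_isAssociatedPrime {M : Type*} [AddCommGroup M]
    [Module R M] [Module.Finite R M] {rs : List R} (h : IsRegular M rs) {P : Ideal R}
    (hP : IsAssociatedPrime P M) : (rs.length : WithBot ℕ∞) ≤ ringKrullDim (R ⧸ P) := by
  induction rs generalizing M P with
  | nil =>
    have := hP.isPrime
    simpa using ringKrullDim_nonneg_of_nontrivial
  | cons x rs ih =>
    obtain ⟨hx, hrs⟩ := (isRegular_cons_iff M x rs).1 h
    have hxm : x ∈ maximalIdeal R := by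
      simpa using fun hu ↦ h.2 (by simp [Ideal.span_singleton_eq_top.mpr hu])
    obtain ⟨hPp, y, hy⟩ := isAssociatedPrime_iff.1 hP
    have hy0 : y ≠ 0 := by
      rintro rfl
      exact hPp.ne_top (by simp [hy])
    have hxP : x ∉ P := by
      rw [hy, Submodule.mem_colon_singleton, Submodule.mem_bot]
      exact fun h0 ↦ hy0 (hx.right_eq_zero_of_smul h0)
    let N : Submodule R M := Submodule.torsionBySet R M (P : Set R)
    -- If N lay in xM, then N = xN, as x is regular and so m' is P-torsion whenever x m' is;
    -- Nakayama would give N = 0, but y is in N.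
    have hN : ¬ N ≤ x • (⊤ : Submodule R M) := by
      intro hle
      have hN0 : N = ⊥ := by
        refine Submodule.eq_bot_of_le_smul_of_le_jacobson_bot (Ideal.span {x}) N
          (IsNoetherian.noetherian N) ?_ ?_
        · intro m hm
          obtain ⟨m', -, rfl⟩ := (Submodule.mem_smul_pointwise_iff_exists _ _ _).1 (hle hm)
          refine Submodule.smul_mem_smul (Ideal.mem_span_singleton_self x) ?_
          simp only [N, Submodule.mem_torsionBySet_iff] at hm ⊢
          intro a
          refine hx.right_eq_zero_of_smul ?_
          rw [smul_comm]
          exact hm a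
        · rw [IsLocalRing.jacobson_eq_maximalIdeal _ bot_ne_top]
          simpa using hxm
      have : y ∈ N := by
        simp only [N, Submodule.mem_torsionBySet_iff]
        rintro ⟨a, ha⟩
        rw [hy] at ha
        simpa [Submodule.mem_colon_singleton] using ha
      rw [hN0] at this
      exact hy0 this
    -- The class of z in M/xM is nonzero and killed by P and x, so it yields an associated prime Q
    -- strictly above P.
    obtain ⟨z, hzN, hz⟩ := Set.not_subset.1 hN
    let z' : QuotSMulTop x M := Submodule.Quotient.mk z
    have hz' : z' ≠ 0 := fun h0 ↦ hz ((Submodule.Quotient.mk_eq_zero _).1 h0)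
    obtain ⟨Q, hQ, hzQ⟩ := exists_le_isAssociatedPrime_of_isNoetherianRing R z' hz'
    have hPQ : P ≤ Q := fun a ha ↦ hzQ <| by
      rw [Submodule.mem_colon_singleton, Submodule.mem_bot]
      have := (Submodule.mem_torsionBySet_iff _ _).1 hzN ⟨a, ha⟩
      change Submodule.Quotient.mk (a • z) = _
      rw [show a • z = 0 from this, Submodule.Quotient.mk_zero]
    have hxQ : x ∈ Q := hzQ <| by
      rw [Submodule.mem_colon_singleton, Submodule.mem_bot]
      change Submodule.Quotient.mk (x • z) = _
      exact (Submodule.Quotient.mk_eq_zero _).2 (Submodule.smul_mem_pointwise_smul _ _ _ trivial)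
    have hdim : ringKrullDim (R ⧸ Q) + 1 ≤ ringKrullDim (R ⧸ P) := by
      refine ringKrullDim_succ_le_of_surjective (Ideal.Quotient.factor hPQ)
        (Ideal.Quotient.factor_surjective hPQ) (r := Ideal.Quotient.mk P x) ?_ ?_
      · rw [mem_nonZeroDivisors_iff_ne_zero]
        rwa [Ne, Ideal.Quotient.eq_zero_iff_mem]
      · rw [Ideal.Quotient.factor_mk, Ideal.Quotient.eq_zero_iff_mem]
        exact hxQ
    refine le_trans ?_ hdim
    rw [List.length_cons, Nat.cast_add, Nat.cast_one]
    gcongr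
    exact ih hrs hQ

universe u

open CategoryTheory Abelian

variable {R : Type u} [CommRing R] [IsNoetherianRing R] [IsLocalRing R]

theorem smul_top_lt_top {R : Type*} [CommRing R] [IsLocalRing R] (M : Type*)
    [AddCommGroup M] [Module R M] [Module.Finite R M] [Nontrivial M] : maximalIdeal R • (⊤ : Submodule R M) < ⊤ :=
  lt_top_iff_ne_top.2 <| Ne.symm <|
    Submodule.top_ne_ideal_smul_of_le_jacobson_annihilator (maximalIdeal_le_jacobson _)

/-- In the long exact sequence, Ext^i(N, M/xM) sits between Ext^i(N, M) and Ext^(i+1)(N, M). -/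
theorem _root_.ModuleCat.subsingleton_ext_quotSMulTop {R : Type u} [CommRing R]
    {N M : ModuleCat.{u} R} {r : ℕ} (h : ∀ i < r + 1, Subsingleton (Ext N M i)) {x : R} (hx : IsSMulRegular M x) :
    ∀ i < r, Subsingleton (Ext N (ModuleCat.of R (QuotSMulTop x M)) i) := by
  intro i hi
  have zero1 := AddCommGrpCat.isZero_of_iff_subsingleton.mpr (h i (by omega))
  have zero2 := AddCommGrpCat.isZero_of_iff_subsingleton.mpr (h (i + 1) (by omega))
  exact AddCommGrpCat.subsingleton_of_isZero <| ShortComplex.Exact.isZero_of_both_zeros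
    ((Ext.covariant_sequence_exact₃' N hx.smulShortComplex_shortExact) i (i + 1) rfl)
    (zero1.eq_zero_of_src _) (zero2.eq_zero_of_tgt _)

/-- The quotient of a module of depth at least `r + 1` by a regular element has depth at least
`r`. -/
theorem exists_isRegular_quotSMulTop (M : Type u) [AddCommGroup M] [Module R M]
    [Module.Finite R M] {rs : List R} (h : IsRegular M rs) {r : ℕ} (hr : rs.length = r + 1)
    {x : R} (hx : IsSMulRegular M x) (hxm : x ∈ maximalIdeal R) :
    ∃ ss : List R, ss.length = r ∧ IsRegular (QuotSMulTop x M) ss := by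
  have := h.nontrivial
  have := nontrivial_quotSMulTop_of_mem_maximalIdeal M hxm
  have hmem : ∀ a ∈ rs, a ∈ maximalIdeal R := by
    intro a ha
    apply IsLocalRing.le_maximalIdeal (J := Ideal.ofList rs)
    · intro ht
      exact h.2 (by simp [ht])
    · exact Ideal.subset_span ha
  -- Depth is measured by the vanishing of Ext from the residue field, which does not depend on the
  -- regular sequence chosen.
  let k := ModuleCat.of R (R ⧸ maximalIdeal R)
  have hk : support R k = PrimeSpectrum.zeroLocus (maximalIdeal R) := by
    rw [support_eq_zeroLocus, Ideal.annihilator_quotient]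
  have h1 := ModuleCat.subsingleton_ext_of_exists_isRegular (maximalIdeal R) k hk.subset
    (ModuleCat.of R M) (smul_top_lt_top M) rs hmem h
  rw [hr] at h1
  obtain ⟨ss, hs, -, hreg⟩ := ModuleCat.exists_isRegular_of_exists_subsingleton_ext
    (maximalIdeal R) r (ModuleCat.of R (QuotSMulTop x M)) (smul_top_lt_top _) k hk
    (ModuleCat.subsingleton_ext_quotSMulTop h1 hx)
  exact ⟨ss, hs, hreg⟩

theorem supportDim_le_supportDim_quotient_add_length (M : Type*) [AddCommGroup M] [Module R M]
    [Module.Finite R M] (fs : List R) (hf : ∀ f ∈ fs, f ∈ maximalIdeal R) :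
    supportDim R M ≤
      supportDim R (M ⧸ (Ideal.ofList fs • ⊤ : Submodule R M)) + fs.length := by
  induction fs generalizing M with
  | nil =>
    rw [Ideal.ofList_nil, Submodule.bot_smul]
    simpa using (supportDim_eq_of_equiv (Submodule.quotEquivOfEqBot ⊥ rfl)).ge
  | cons x fs ih =>
    rw [supportDim_eq_of_equiv (Submodule.quotOfListConsSMulTopEquivQuotSMulTopInner M x fs)]
    refine (supportDim_le_supportDim_quotSMulTop_succ (hf x (by simp))).trans ?_
    have := ih (QuotSMulTop x M) (fun f h ↦ hf f (by simp [h]))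
    rw [List.length_cons, Nat.cast_add, Nat.cast_one, ← add_assoc]
    gcongr

/-- A system of parameters of a Cohen-Macaulay module over a local ring is a regular sequence. -/
theorem isWeaklyRegular_of_supportDim_quotient_add_length_le (M : Type u) [AddCommGroup M]
    [Module R M] [Module.Finite R M] {rs : List R} (h : IsRegular M rs) (fs : List R)
    (hf : ∀ f ∈ fs, f ∈ maximalIdeal R)
    (hdim : supportDim R (M ⧸ (Ideal.ofList fs • ⊤ : Submodule R M)) + fs.length ≤ rs.length) :
    IsWeaklyRegular M fs := by
  induction fs generalizing M rs with
  | nil => exact .nil R M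
  | cons x fs ih =>
    have hx := hf x (by simp)
    have hf' : ∀ f ∈ fs, f ∈ maximalIdeal R := fun f h ↦ hf f (by simp [h])
    rw [supportDim_eq_of_equiv (Submodule.quotOfListConsSMulTopEquivQuotSMulTopInner M x fs),
      List.length_cons, Nat.cast_add, Nat.cast_one, ← add_assoc] at hdim
    have hle : supportDim R (QuotSMulTop x M) + 1 ≤ rs.length := by
      refine le_trans ?_ hdim
      gcongr
      exact supportDim_le_supportDim_quotient_add_length _ fs hf'
    have := h.nontrivial
    have := nontrivial_quotSMulTop_of_mem_maximalIdeal M hx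
    -- A zero-divisor x would lie in an associated prime P of M, which is then in the support of
    -- M/xM; so dim M/xM ≥ dim R/P ≥ `rs.length`, against `hle`.
    have hxreg : IsSMulRegular M x := by
      by_contra hcon
      obtain ⟨y, hy, hy0⟩ : ∃ y : M, x • y = 0 ∧ y ≠ 0 := by
        by_contra! hall
        exact hcon (.of_right_eq_zero_of_smul hall)
      obtain ⟨P, hP, hyP⟩ := exists_le_isAssociatedPrime_of_isNoetherianRing R y hy0
      have hxP : x ∈ P := hyP (by simpa [Submodule.mem_colon_singleton] using hy)
      have hPp := hP.isPrime
      have h1 := length_le_ringKrullDim_quotient_of_isAssociatedPrime h hP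
      have h2 : ringKrullDim (R ⧸ P) ≤ supportDim R (QuotSMulTop x M) := by
        have hPs : (⟨P, hPp⟩ : PrimeSpectrum R) ∈ support R (QuotSMulTop x M) := by
          rw [support_quotSMulTop]
          refine ⟨?_, by simpa using hxP⟩
          rw [mem_support_iff_of_finite, ← Submodule.annihilator_top]
          exact hP.annihilator_le
        rw [mem_support_iff_of_finite] at hPs
        rw [supportDim_eq_ringKrullDim_quotient_annihilator]
        exact ringKrullDim_le_of_surjective (Ideal.Quotient.factor hPs)
          (Ideal.Quotient.factor_surjective hPs)
      have h3 : ((rs.length : ℕ) : WithBot ℕ∞) + 1 ≤ rs.length :=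
        le_trans (by gcongr; exact h1.trans h2) hle
      exact absurd (by exact_mod_cast h3) (Nat.not_succ_le_self rs.length)
    obtain ⟨r, hr⟩ : ∃ r, rs.length = r + 1 := by
      refine Nat.exists_eq_succ_of_ne_zero fun h0 ↦ ?_
      have h1 : (0 : WithBot ℕ∞) ≤ supportDim R (QuotSMulTop x M) := by
        rw [supportDim_eq_ringKrullDim_quotient_annihilator]
        have : Nontrivial (R ⧸ annihilator R (QuotSMulTop x M)) := by
          rw [Ideal.Quotient.nontrivial_iff, Ne, annihilator_eq_top_iff]
          exact not_subsingleton _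
        exact ringKrullDim_nonneg_of_nontrivial
      have h3 : (0 : WithBot ℕ∞) + 1 ≤ (0 : ℕ) := le_trans (by gcongr) (h0 ▸ hle)
      exact absurd h3 (by simp)
    obtain ⟨ss, hs, hss⟩ := exists_isRegular_quotSMulTop M h hr hxreg hx
    refine .cons hxreg (ih (QuotSMulTop x M) hss hf' ?_)
    rw [hs]
    rw [hr, Nat.cast_add, Nat.cast_one] at hdim
    exact (ENat.WithBot.add_le_add_natCast_right_iff (c := 1)).1 (by exact_mod_cast hdim)

end IsLocalRing

/-! ### Regular sequences and heights -/

namespace RingTheory.Sequence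

theorem isWeaklyRegular_self_iff {R : Type*} [CommRing R] (rs : List R) :
    IsWeaklyRegular R rs ↔ ∀ (i : ℕ) (h : i < rs.length) (r : R),
      rs[i] * r ∈ Ideal.ofList (rs.take i) → r ∈ Ideal.ofList (rs.take i) := by
  rw [isWeaklyRegular_iff]
  refine forall₂_congr fun i h ↦ ?_
  rw [isSMulRegular_quotient_iff_mem_of_smul_mem]
  simp

/-- A prime containing a weakly regular sequence has height at least its length. -/
theorem length_le_height_of_isWeaklyRegular {R : Type*} [CommRing R]
    {rs : List R} (h : IsWeaklyRegular R rs) {P : Ideal R} [hP : P.IsPrime]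
    (hle : Ideal.ofList rs ≤ P) : (rs.length : ℕ∞) ≤ P.height := by
  induction rs using List.reverseRecOn generalizing P with
  | nil => simp
  | append_singleton rs x ih =>
    rw [isWeaklyRegular_append_iff, isWeaklyRegular_singleton_iff] at h
    obtain ⟨hrs, hx⟩ := h
    rw [Ideal.ofList_append, Ideal.ofList_singleton, sup_le_iff, Ideal.span_singleton_le_iff_mem]
      at hle
    obtain ⟨Q, hQ, hQP⟩ := Ideal.exists_minimalPrimes_le hle.1
    have := hQ.isPrime
    have hxQ : x ∉ Q := by
      refine hx.notMem_of_mem_minimalPrimes ?_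
      simpa [Ideal.annihilator_quotient] using hQ
    have hlt : Q < P := lt_of_le_of_ne hQP (fun e ↦ hxQ (e ▸ hle.2))
    refine le_trans ?_ (Ideal.height_add_one_le_of_lt_of_isPrime hlt)
    simpa using ih hrs hQ.1.2

end RingTheory.Sequence

/-! ### Coordinate primes and homogeneous ideals -/

namespace MvPolynomial

variable {σ K : Type*} [Field K]

instance isPrime_span_X_image (s : Set σ) :
    (Ideal.span (X '' s : Set (MvPolynomial σ K))).IsPrime := by
  classical
  let φ : MvPolynomial σ K →ₐ[K] MvPolynomial σ K := aeval fun i ↦ if i ∈ s then 0 else X i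
  let I : Ideal (MvPolynomial σ K) := Ideal.span (X '' s)
  have hφ : (Ideal.Quotient.mkₐ K I).comp φ = Ideal.Quotient.mkₐ K I := by
    ext i
    by_cases hi : i ∈ s
    · have : (X i : MvPolynomial σ K) ∈ I := Ideal.subset_span ⟨i, hi, rfl⟩
      simp [φ, hi, Ideal.Quotient.eq_zero_iff_mem.2 this]
    · simp [φ, hi]
  have : I = RingHom.ker φ := by
    refine le_antisymm (Ideal.span_le.2 ?_) fun f hf ↦ ?_
    · rintro _ ⟨i, hi, rfl⟩
      simp [φ, hi]
    · have := DFunLike.congr_fun hφ f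
      rw [AlgHom.comp_apply, (RingHom.mem_ker).1 hf, map_zero] at this
      exact Ideal.Quotient.eq_zero_iff_mem.1 this.symm
  change I.IsPrime
  rw [this]
  exact RingHom.ker_isPrime _

theorem X_mem_span_X_image_iff {s : Set σ} {i : σ} :
    (X i : MvPolynomial σ K) ∈ Ideal.span (X '' s) ↔ i ∈ s := by
  classical
  refine ⟨fun h ↦ ?_, fun h ↦ Ideal.subset_span ⟨i, h, rfl⟩⟩
  obtain ⟨j, hj, hne⟩ := mem_ideal_span_X_image.1 h (Finsupp.single i 1) (by simp [support_X])
  rw [Finsupp.single_apply_ne_zero] at hne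
  exact hne.1 ▸ hj

theorem card_le_height_of_X_mem {s : Finset σ} {P : Ideal (MvPolynomial σ K)}
    (hP : ∀ i ∈ s, X i ∈ P) : (s.card : ℕ∞) ≤ P.height := by
  classical
  have key : ∀ s : Finset σ,
      (s.card : ℕ∞) ≤ (Ideal.span (X '' (s : Set σ) : Set (MvPolynomial σ K))).height := by
    intro s
    induction s using Finset.induction_on with
    | empty => simp
    | insert i s hi ih =>
      rw [Finset.card_insert_of_notMem hi, Nat.cast_add, Nat.cast_one]
      refine (add_le_add_left ih 1).trans (Ideal.height_add_one_le_of_lt_of_isPrime ?_)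
      refine lt_of_le_of_ne (Ideal.span_mono (Set.image_mono (by simp))) fun e ↦ hi ?_
      have : (X i : MvPolynomial σ K) ∈ Ideal.span (X '' (s : Set σ)) := by
        rw [e]
        exact X_mem_span_X_image_iff.2 (by simp)
      simpa using X_mem_span_X_image_iff.1 this
  refine (key s).trans (Ideal.height_mono (Ideal.span_le.2 ?_))
  rintro _ ⟨i, hi, rfl⟩
  exact hP i hi

theorem isWeaklyRegular_ofFn_X (n : ℕ) :
    RingTheory.Sequence.IsWeaklyRegular (MvPolynomial (Fin n) K)
      (List.ofFn (X : Fin n → MvPolynomial (Fin n) K)) := by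
  rw [RingTheory.Sequence.isWeaklyRegular_self_iff]
  intro i hi r hr
  have hin : i < n := by simpa using hi
  have hspan : Ideal.ofList ((List.ofFn (X : Fin n → MvPolynomial (Fin n) K)).take i) =
      Ideal.span (X '' {j : Fin n | (j : ℕ) < i}) := by
    refine congrArg Ideal.span (Set.ext fun f ↦ ?_)
    simp only [Set.mem_ofPred_eq, List.mem_take_iff_getElem, List.getElem_ofFn, Set.mem_image]
    constructor
    · rintro ⟨j, hj, rfl⟩
      exact ⟨⟨j, by simp at hj; omega⟩, by simp at hj ⊢; omega, rfl⟩
    · rintro ⟨j, hj, rfl⟩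
      exact ⟨j, by simp; omega, rfl⟩
  rw [hspan] at hr ⊢
  refine (Ideal.IsPrime.mem_or_mem inferInstance hr).resolve_left fun h ↦ ?_
  rw [List.getElem_ofFn, X_mem_span_X_image_iff] at h
  simp at h

theorem coeff_zero_ne_zero_of_notMem_span_X {f : MvPolynomial σ K}
    (hf : f ∉ Ideal.span (X '' (Set.univ : Set σ))) : coeff 0 f ≠ 0 := by
  rw [mem_ideal_span_X_image] at hf
  push Not at hf
  obtain ⟨m, hm, h0⟩ := hf
  have : m = 0 := Finsupp.ext fun i ↦ h0 i trivial
  simpa [this] using hm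

/-- A polynomial with nonzero constant term is a nonzerodivisor modulo every homogeneous ideal. -/
theorem mem_of_mul_mem_of_coeff_zero_ne_zero {w : σ → ℕ} (hw : ∀ i, 0 < w i)
    {I : Ideal (MvPolynomial σ K)}
    (hI : let _ := weightedGradedAlgebra K w
      I.IsHomogeneous (weightedHomogeneousSubmodule K w)) {u f : MvPolynomial σ K}
    (hu : coeff 0 u ≠ 0) (huf : u * f ∈ I) : f ∈ I := by
  let _ := weightedGradedAlgebra K w
  rw [mem_iff_weightedHomogeneousComponent_mem K w hI] at huf ⊢
  intro d
  induction d using Nat.strong_induction_on with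
  | _ d ih =>
    have hu0 : weightedHomogeneousComponent w 0 u = C (coeff 0 u) :=
      weightedHomogeneousComponent_zero u fun i ↦ (hw i).ne'
    have hmul : weightedHomogeneousComponent w d (u * f) =
        ∑ ij ∈ Finset.HasAntidiagonal.antidiagonal d,
          weightedHomogeneousComponent w ij.1 u * weightedHomogeneousComponent w ij.2 f := by
      have := DirectSum.coe_mul_apply_eq_sum_antidiagonal (weightedHomogeneousSubmodule K w)
        (DirectSum.decompose _ u) (DirectSum.decompose _ f) d
      rw [← DirectSum.decompose_mul] at this
      simp only [← weightedDecomposition.decompose'_apply]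
      exact this
    have hd := huf d
    rw [hmul, Finset.Nat.sum_antidiagonal_eq_sum_range_succ_mk, Finset.sum_range_succ', Nat.sub_zero,
      hu0] at hd
    -- The degree d part of u f is u₀ f_d plus products with components of f of lower degree, which
    -- lie in I by induction; u₀ is a nonzero scalar.
    have h1 : ∑ k ∈ Finset.range d, weightedHomogeneousComponent w (k + 1) u *
        weightedHomogeneousComponent w (d - (k + 1)) f ∈ I :=
      Ideal.sum_mem _ fun k hk ↦ Ideal.mul_mem_left _ _
        (ih _ (by have := Finset.mem_range.1 hk; omega))
    have h2 := (Ideal.add_mem_iff_right I h1).1 hd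
    have h3 := Ideal.mul_mem_left I (C (coeff 0 u)⁻¹) h2
    rwa [← mul_assoc, ← C_mul, inv_mul_cancel₀ hu, C_1, one_mul] at h3

end MvPolynomial

/-! ### Regularity from a height bound -/

namespace MvPolynomial

universe u

variable {K : Type u} [Field K]

theorem height_span_X_le (n : ℕ) :
    (Ideal.span (X '' (Set.univ : Set (Fin n)) : Set (MvPolynomial (Fin n) K))).height ≤ n := by
  have h := Ideal.height_le_card_of_mem_minimalPrimes_span (R := MvPolynomial (Fin n) K)
    (s := X '' (Set.univ : Set (Fin n))) (Set.toFinite _)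
    (by rw [Ideal.minimalPrimes_eq_subsingleton_self]; rfl)
  refine h.trans (Nat.cast_le.2 ?_)
  simpa using Set.ncard_image_le (f := (X : Fin n → MvPolynomial (Fin n) K)) (s := Set.univ)
    (Set.toFinite _)

theorem eq_span_X_of_le_of_le_height {n : ℕ} {P : Ideal (MvPolynomial (Fin n) K)} [P.IsPrime]
    (hle : P ≤ Ideal.span (X '' (Set.univ : Set (Fin n)))) (hP : (n : ℕ∞) ≤ P.height) :
    P = Ideal.span (X '' (Set.univ : Set (Fin n))) :=
  Ideal.eq_of_le_of_height_le P hle ((height_span_X_le n).trans hP)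

/-- The variables form a regular sequence of length n in the localization at m, so n elements of m
with a zero-dimensional quotient there are regular. -/
theorem isWeaklyRegular_of_forall_le_height {n : ℕ} {w : Fin n → ℕ} (hw : ∀ i, 0 < w i)
    (fs : List (MvPolynomial (Fin n) K)) (hlen : fs.length = n)
    (hmem : ∀ f ∈ fs, f ∈ Ideal.span (X '' (Set.univ : Set (Fin n))))
    (hhom : ∀ f ∈ fs, ∃ d, IsWeightedHomogeneous w f d)
    (hht : ∀ P : Ideal (MvPolynomial (Fin n) K), P.IsPrime → Ideal.ofList fs ≤ P →
      (n : ℕ∞) ≤ P.height) :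
    RingTheory.Sequence.IsWeaklyRegular (MvPolynomial (Fin n) K) fs := by
  let m : Ideal (MvPolynomial (Fin n) K) := Ideal.span (X '' (Set.univ : Set (Fin n)))
  have hm : m.IsPrime := isPrime_span_X_image _
  let S := Localization.AtPrime m
  have hX : RingTheory.Sequence.IsRegular S
      ((List.ofFn (X : Fin n → MvPolynomial (Fin n) K)).map (algebraMap _ S)) := by
    refine (isWeaklyRegular_ofFn_X n).isRegular_of_isLocalization_of_mem S m fun r hr ↦ ?_
    obtain ⟨i, rfl⟩ := List.mem_ofFn.1 hr
    exact Ideal.subset_span ⟨i, trivial, rfl⟩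
  have hdim : Ring.KrullDimLE 0 (S ⧸ Ideal.ofList (fs.map (algebraMap _ S))) := by
    rw [Ideal.krullDimLE_zero_quotient_iff_forall_minimalPrimes_isMaximal]
    intro J hJ
    have := hJ.isPrime
    have hle : J.under (MvPolynomial (Fin n) K) ≤ m := by
      refine le_trans ?_ (IsLocalization.AtPrime.under_maximalIdeal S m).le
      exact Ideal.comap_mono (IsLocalRing.le_maximalIdeal this.ne_top)
    have hfs : Ideal.ofList fs ≤ J.under (MvPolynomial (Fin n) K) := by
      rw [Ideal.under_def, ← Ideal.map_le_iff_le_comap, Ideal.map_ofList]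
      exact hJ.1.2
    have heq := eq_span_X_of_le_of_le_height hle (hht _ inferInstance hfs)
    have hJm : J = IsLocalRing.maximalIdeal S := by
      rw [← IsLocalization.map_under m.primeCompl S J, heq]
      exact Localization.AtPrime.map_eq_maximalIdeal
    rw [hJm]
    infer_instance
  have hS := IsLocalRing.isWeaklyRegular_of_supportDim_quotient_add_length_le S hX
    (fs.map (algebraMap _ S)) ?_ ?_
  -- Returning from the localization costs a factor u outside m; its constant term is nonzero, so it
  -- cancels modulo a homogeneous ideal.
  · rw [RingTheory.Sequence.isWeaklyRegular_self_iff] at hS ⊢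
    intro i hi r hr
    have h1 := hS i (by simpa using hi) (algebraMap _ S r) (by
      rw [List.getElem_map, ← map_mul, ← List.map_take, ← Ideal.map_ofList]
      exact Ideal.mem_map_of_mem _ hr)
    rw [← List.map_take, ← Ideal.map_ofList,
      IsLocalization.algebraMap_mem_map_algebraMap_iff m.primeCompl] at h1
    obtain ⟨u, hu, hur⟩ := h1
    refine mem_of_mul_mem_of_coeff_zero_ne_zero hw ?_ (coeff_zero_ne_zero_of_notMem_span_X hu) hur
    let _ := weightedGradedAlgebra K w
    refine Ideal.homogeneous_span _ _ fun f hf ↦ ?_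
    obtain ⟨d, hd⟩ := hhom f (List.mem_of_mem_take hf)
    exact ⟨d, hd⟩
  · intro f hf
    obtain ⟨g, hg, rfl⟩ := List.mem_map.1 hf
    exact (IsLocalization.AtPrime.to_map_mem_maximal_iff S m g).2 (hmem g hg)
  · rw [smul_eq_mul, Ideal.mul_top, Module.supportDim_quotient_eq_ringKrullDim]
    have := Ring.krullDimLE_iff.1 hdim
    simp only [List.length_map, List.length_ofFn, hlen]
    exact (add_le_add_left this _).trans (by simp)

end MvPolynomial

/-! ### General forms and the semigroup condition -/

namespace MvPolynomial

theorem mem_closure_image_iff_exists_weight {σ : Type*} {w : σ → ℕ} {s : Set σ} {d : ℕ} :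
    d ∈ AddSubmonoid.closure (w '' s) ↔
      ∃ m : σ →₀ ℕ, (∀ i ∈ m.support, i ∈ s) ∧ Finsupp.weight w m = d := by
  classical
  constructor
  · intro h
    induction h using AddSubmonoid.closure_induction with
    | mem x hx =>
      obtain ⟨i, hi, rfl⟩ := hx
      refine ⟨Finsupp.single i 1, fun j hj ↦ ?_, by simp [Finsupp.weight_single]⟩
      have := Finsupp.support_single_subset hj
      rw [Finset.mem_singleton] at this
      exact this ▸ hi
    | zero => exact ⟨0, by simp, by simp⟩
    | add x y _ _ hx hy =>
      obtain ⟨m, hm, rfl⟩ := hx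
      obtain ⟨m', hm', rfl⟩ := hy
      refine ⟨m + m', fun j hj ↦ ?_, by simp⟩
      rcases Finset.mem_union.1 (Finsupp.support_add hj) with h | h
      exacts [hm j h, hm' j h]
  · rintro ⟨m, hm, rfl⟩
    rw [Finsupp.weight_apply]
    exact AddSubmonoid.sum_mem _ fun i hi ↦
      AddSubmonoid.nsmul_mem _ (AddSubmonoid.subset_closure (Set.mem_image_of_mem w (hm i hi))) _

variable {σ ι K : Type*} [Field K]

theorem monomial_notMem_of_isPrime {P : Ideal (MvPolynomial σ K)} [hP : P.IsPrime]
    {m : σ →₀ ℕ} (hm : ∀ i ∈ m.support, X i ∉ P) : monomial m (1 : K) ∉ P := by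
  rw [monomial_eq, C_1, one_mul, Finsupp.prod, hP.prod_mem_iff]
  rintro ⟨i, hi, h⟩
  exact hm i hi (hP.mem_of_pow_mem _ h)

/-- For each Q some monomial of degree d in the variables outside Q avoids Q, so the forms of degree
d in Q are a proper subspace; over an infinite field finitely many of these do not cover. -/
theorem exists_isWeightedHomogeneous_forall_notMem [Infinite K] {w : σ → ℕ} {d : ℕ}
    {𝒬 : Set (Ideal (MvPolynomial σ K))} (hfin : 𝒬.Finite)
    (h𝒬 : ∀ Q ∈ 𝒬, Q.IsPrime ∧ d ∈ AddSubmonoid.closure (w '' {i | X i ∉ Q})) :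
    ∃ f : MvPolynomial σ K, IsWeightedHomogeneous w f d ∧ ∀ Q ∈ 𝒬, f ∉ Q := by
  classical
  let V := weightedHomogeneousSubmodule K w d
  let s : Finset (Submodule K V) := hfin.toFinset.image fun Q ↦
    (Q.restrictScalars K).comap V.subtype
  have hs : ⊤ ∉ s := by
    intro h
    obtain ⟨Q, hQ, hQt⟩ := Finset.mem_image.1 h
    obtain ⟨hQp, hd⟩ := h𝒬 Q (hfin.mem_toFinset.1 hQ)
    obtain ⟨m, hm, hmd⟩ := mem_closure_image_iff_exists_weight.1 hd
    have : (⟨monomial m 1, isWeightedHomogeneous_monomial w m 1 hmd⟩ : V) ∈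
        (Q.restrictScalars K).comap V.subtype := hQt ▸ trivial
    exact monomial_notMem_of_isPrime hm this
  obtain ⟨f, hf⟩ := (Set.ne_univ_iff_exists_notMem _).1
    (Subspace.biUnion_ne_univ_of_top_notMem hs)
  refine ⟨f, f.2, fun Q hQ hfQ ↦ hf ?_⟩
  simp only [Set.mem_iUnion]
  exact ⟨_, Finset.mem_image_of_mem _ (hfin.mem_toFinset.2 hQ), hfQ⟩

open Classical in
/-- General homogeneous polynomials cut each coordinate stratum properly, as far as there are
monomials of their degrees that do not vanish on it. -/
theorem exists_isWeightedHomogeneous_card_le_height [Infinite K] [Fintype σ] (w : σ → ℕ)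
    (a : ι → ℕ) (T : Finset ι) :
    ∃ f : ι → MvPolynomial σ K, (∀ j ∈ T, IsWeightedHomogeneous w (f j) (a j)) ∧
      ∀ P : Ideal (MvPolynomial σ K), P.IsPrime → (∀ j ∈ T, f j ∈ P) →
        (((Finset.univ.filter fun i ↦ X i ∈ P).card + (T.filter fun j ↦
          a j ∈ AddSubmonoid.closure (w '' {i | X i ∉ P})).card : ℕ) : ℕ∞) ≤ P.height := by
  induction T using Finset.induction_on with
  | empty =>
    refine ⟨0, by simp, fun P _ _ ↦ ?_⟩
    simpa using card_le_height_of_X_mem (P := P) (s := Finset.univ.filter fun i ↦ X i ∈ P) (by simp)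
  | insert j T hj ih =>
    obtain ⟨f, hf, hht⟩ := ih
    -- Letting s run over all sets of variables makes one choice of g serve every P: below, s is the
    -- set of variables in P.
    let 𝒬 : Set (Ideal (MvPolynomial σ K)) := {Q ∈ ⋃ s : Set σ,
      (Ideal.span (f '' T) ⊔ Ideal.span (X '' s)).minimalPrimes |
        a j ∈ AddSubmonoid.closure (w '' {i | X i ∉ Q})}
    have hfin : 𝒬.Finite := (Set.finite_iUnion fun s ↦
      Ideal.finite_minimalPrimes_of_isNoetherianRing _ _).subset fun Q hQ ↦ hQ.1
    obtain ⟨g, hg, hgQ⟩ := exists_isWeightedHomogeneous_forall_notMem hfin fun Q hQ ↦ by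
      obtain ⟨s, hs⟩ := Set.mem_iUnion.1 hQ.1
      exact ⟨hs.isPrime, hQ.2⟩
    have hupd : ∀ k ∈ T, Function.update f j g k = f k := fun k hk ↦
      Function.update_of_ne (ne_of_mem_of_not_mem hk hj) _ _
    refine ⟨Function.update f j g, ?_, fun P hP hfP ↦ ?_⟩
    · intro k hk
      rcases Finset.mem_insert.1 hk with rfl | hk
      · simpa using hg
      · rw [hupd k hk]
        exact hf k hk
    have hgP : g ∈ P := by simpa using hfP j (by simp)
    have hfT : ∀ k ∈ T, f k ∈ P := fun k hk ↦ by
      simpa [hupd k hk] using hfP k (by simp [hk])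
    by_cases ha : a j ∈ AddSubmonoid.closure (w '' {i | X i ∉ P})
    · rw [Finset.filter_insert, if_pos ha, Finset.card_insert_of_notMem (by simp [hj]),
        ← add_assoc, Nat.cast_add, Nat.cast_one]
      have hle : Ideal.span (f '' T) ⊔ Ideal.span (X '' {i | X i ∈ P}) ≤ P := by
        refine sup_le (Ideal.span_le.2 ?_) (Ideal.span_le.2 ?_)
        · rintro _ ⟨k, hk, rfl⟩
          exact hfT k hk
        · rintro _ ⟨i, hi, rfl⟩
          exact hi
      obtain ⟨Q, hQ, hQP⟩ := Ideal.exists_minimalPrimes_le hle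
      have hQp := hQ.isPrime
      -- Q and P contain the same variables, so both counts for T agree; g lies in P but not in Q,
      -- which supplies the extra unit of height.
      have hX : ∀ i, X i ∈ Q ↔ X i ∈ P := fun i ↦ ⟨fun h ↦ hQP h, fun h ↦
        hQ.1.2 (Ideal.mem_sup_right (Ideal.subset_span ⟨i, h, rfl⟩))⟩
      have hfQ : ∀ k ∈ T, f k ∈ Q := fun k hk ↦
        hQ.1.2 (Ideal.mem_sup_left (Ideal.subset_span ⟨k, hk, rfl⟩))
      have hlt : Q < P := by
        refine lt_of_le_of_ne hQP fun e ↦ hgQ Q ⟨Set.mem_iUnion.2 ⟨_, hQ⟩, ?_⟩ (e ▸ hgP)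
        simpa only [hX] using ha
      have := hht Q hQp hfQ
      simp only [hX] at this
      exact (add_le_add_left this 1).trans (Ideal.height_add_one_le_of_lt_of_isPrime hlt)
    · rw [Finset.filter_insert, if_neg ha]
      exact hht P hP hfT

/-- A regular sequence of homogeneous elements, as many as there are variables, has on each
coordinate subspace at least as many members that do not vanish identically as its dimension. -/
theorem card_le_card_filter_mem_closure {n : ℕ} {w a : Fin n → ℕ}
    {f : Fin n → MvPolynomial (Fin n) K}
    (hf : ∀ j, IsWeightedHomogeneous w (f j) (a j))
    (hmem : ∀ j, f j ∈ Ideal.span (X '' (Set.univ : Set (Fin n))))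
    (hreg : RingTheory.Sequence.IsWeaklyRegular (MvPolynomial (Fin n) K) (List.ofFn f))
    (I : Finset (Fin n)) [DecidablePred fun j ↦ a j ∈ AddSubmonoid.closure (w '' (I : Set (Fin n)))] :
    I.card ≤ (Finset.univ.filter fun j ↦
      a j ∈ AddSubmonoid.closure (w '' (I : Set (Fin n)))).card := by
  classical
  let J := Finset.univ.filter fun j ↦ a j ∈ AddSubmonoid.closure (w '' (I : Set (Fin n)))
  let G : Finset (MvPolynomial (Fin n) K) := Iᶜ.image X ∪ J.image f
  have hG : Ideal.span (G : Set (MvPolynomial (Fin n) K)) ≤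
      Ideal.span (X '' (Set.univ : Set (Fin n))) := by
    refine Ideal.span_le.2 fun g hg ↦ ?_
    rcases Finset.mem_union.1 hg with h | h
    · obtain ⟨i, -, rfl⟩ := Finset.mem_image.1 h
      exact Ideal.subset_span ⟨i, trivial, rfl⟩
    · obtain ⟨j, -, rfl⟩ := Finset.mem_image.1 h
      exact hmem j
  obtain ⟨P, hP, -⟩ := Ideal.exists_minimalPrimes_le hG
  have hPp := hP.isPrime
  have hfP : Ideal.ofList (List.ofFn f) ≤ P := by
    refine Ideal.span_le.2 fun g hg ↦ ?_
    obtain ⟨j, rfl⟩ := List.mem_ofFn.1 hg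
    by_cases hj : j ∈ J
    · exact hP.1.2 (Ideal.subset_span (Finset.mem_union_right _ (Finset.mem_image_of_mem f hj)))
    -- A monomial of f_j in the variables of I alone would put a_j in the semigroup.
    have hfj : f j ∈ Ideal.span (X '' ((Iᶜ : Finset (Fin n)) : Set (Fin n))) := by
      rw [mem_ideal_span_X_image]
      intro m hm
      by_contra! hcon
      refine hj (Finset.mem_filter.2 ⟨Finset.mem_univ _, ?_⟩)
      refine mem_closure_image_iff_exists_weight.2 ⟨m, fun i hi ↦ ?_, hf j (mem_support_iff.1 hm)⟩
      by_contra hiI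
      exact Finsupp.mem_support_iff.1 hi (hcon i (by simpa using hiI))
    refine (Ideal.span_le.2 ?_ : _ ≤ P) hfj
    rintro _ ⟨i, hi, rfl⟩
    exact hP.1.2 (Ideal.subset_span (Finset.mem_union_left _ (Finset.mem_image_of_mem X hi)))
  have h1 := RingTheory.Sequence.length_le_height_of_isWeaklyRegular hreg hfP
  have h2 := Ideal.height_le_card_of_mem_minimalPrimes_span_finset hP
  have h3 : n ≤ G.card := by
    rw [List.length_ofFn] at h1
    exact_mod_cast h1.trans h2
  have h4 : G.card ≤ Iᶜ.card + J.card :=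
    (Finset.card_union_le _ _).trans (add_le_add Finset.card_image_le Finset.card_image_le)
  have h5 := Finset.card_add_card_compl I
  rw [Fintype.card_fin] at h5
  change I.card ≤ J.card
  omega

theorem IsWeightedHomogeneous.mem_span_X {w : σ → ℕ} {f : MvPolynomial σ K} {d : ℕ}
    (hf : IsWeightedHomogeneous w f d) (hd : 0 < d) :
    f ∈ Ideal.span (X '' (Set.univ : Set σ)) := by
  rw [mem_ideal_span_X_image]
  intro m hm
  by_contra! hcon
  have h0 : m = 0 := Finsupp.ext fun i ↦ hcon i trivial
  have := hf (mem_support_iff.1 hm)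
  simp [h0] at this
  omega

end MvPolynomial

/-! ### The implications between the three conditions -/

section

open MvPolynomial

theorem ofFn_subset_span_X {n : ℕ} {a b : Fin n → ℕ} (ha : ∀ i, 0 < a i)
    {f : Fin n → MvPolynomial (Fin n) ℂ} (hf : ∀ i, IsWeightedHomogeneous b (f i) (a i)) :
    ∀ g ∈ List.ofFn f, g ∈ Ideal.span (X '' (Set.univ : Set (Fin n))) := by
  intro g hg
  obtain ⟨i, rfl⟩ := List.mem_ofFn.1 hg
  exact (hf i).mem_span_X (ha i)

theorem exists_isHomogeneousRegularSequence {n : ℕ} {a b : Fin n → ℕ}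
    (ha : ∀ i, 0 < a i) (hb : ∀ i, 0 < b i)
    (h : ∀ s : Set (Fin n), s.ncard ≤ {j | a j ∈ AddSubmonoid.closure (b '' s)}.ncard) :
    ∃ f : Fin n → MvPolynomial (Fin n) ℂ, IsHomogeneousRegularSequence a b f := by
  classical
  obtain ⟨f, hf, hht⟩ := exists_isWeightedHomogeneous_card_le_height (K := ℂ) b a Finset.univ
  have hf : ∀ i, IsWeightedHomogeneous b (f i) (a i) := fun i ↦ hf i (Finset.mem_univ i)
  have hmem := ofFn_subset_span_X ha hf
  have hreg : RingTheory.Sequence.IsWeaklyRegular (MvPolynomial (Fin n) ℂ) (List.ofFn f) := by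
    refine isWeaklyRegular_of_forall_le_height hb _ (by simp) hmem ?_ ?_
    · intro g hg
      obtain ⟨i, rfl⟩ := List.mem_ofFn.1 hg
      exact ⟨_, hf i⟩
    · intro P hP hle
      refine le_trans (Nat.cast_le.2 ?_) (hht P hP fun j _ ↦
        hle (Ideal.subset_span (List.mem_ofFn.2 ⟨j, rfl⟩)))
      -- Condition 3 for the variables outside P turns the lower bound on the height into n.
      have h1 := h {i | X i ∉ P}
      rw [Set.ncard_eq_toFinset_card', Set.ncard_eq_toFinset_card', Set.toFinset_ofPred,
        Set.toFinset_ofPred] at h1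
      have h2 := Finset.card_filter_add_card_filter_not (s := (Finset.univ : Finset (Fin n)))
        (fun i ↦ (X i : MvPolynomial (Fin n) ℂ) ∈ P)
      rw [Finset.card_univ, Fintype.card_fin] at h2
      calc n = _ := h2.symm
        _ ≤ _ := by gcongr
  have htop : (⊤ : Ideal (MvPolynomial (Fin n) ℂ)) ≠
      Ideal.ofList (List.ofFn f) • (⊤ : Ideal (MvPolynomial (Fin n) ℂ)) := by
    rw [smul_eq_mul, Ideal.mul_top]
    intro e
    exact (isPrime_span_X_image (K := ℂ) (Set.univ : Set (Fin n))).ne_top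
      (top_le_iff.1 (e.le.trans (Ideal.span_le.2 hmem)))
  refine ⟨f, fun i h0 ↦ htop ?_, hf, hreg, htop⟩
  rw [RingTheory.Sequence.isWeaklyRegular_self_iff] at hreg
  -- If f_i were 0, regularity applied to f_i · 1 = 0 would put 1 in the ideal of the earlier terms.
  have h1 := hreg i (by simp) 1 (by simp [h0])
  rw [smul_eq_mul, Ideal.mul_top, eq_comm, Ideal.eq_top_iff_one]
  exact Ideal.span_mono (fun g hg ↦ List.mem_of_mem_take hg) h1

theorem IsHomogeneousRegularSequence.zeroLocus_eq_empty {n : ℕ} {a b : Fin n → ℕ}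
    (hb : ∀ i, 0 < b i)
    {f : Fin n → MvPolynomial (Fin n) ℂ} (hf : IsHomogeneousRegularSequence a b f) :
    ProjectiveSpectrum.zeroLocus (weightedGrading b) (Set.range f) = ∅ := by
  rw [Set.eq_empty_iff_forall_notMem]
  intro p hp
  have hpp := p.isPrime
  let P : Ideal (MvPolynomial (Fin n) ℂ) := p.asHomogeneousIdeal.toIdeal
  have hPle : P ≤ Ideal.span (X '' (Set.univ : Set (Fin n))) := by
    intro g hg
    by_contra hgm
    refine hpp.ne_top ((Ideal.eq_top_iff_one _).2 ?_)
    exact mem_of_mul_mem_of_coeff_zero_ne_zero (I := P) hb p.asHomogeneousIdeal.isHomogeneous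
      (coeff_zero_ne_zero_of_notMem_span_X hgm) (by rwa [mul_one])
  have hfP : Ideal.ofList (List.ofFn f) ≤ P := by
    refine Ideal.span_le.2 fun g hg ↦ ?_
    exact hp (List.mem_ofFn.1 hg)
  have hht := RingTheory.Sequence.length_le_height_of_isWeaklyRegular
    hf.regular.toIsWeaklyRegular hfP
  rw [List.length_ofFn] at hht
  have heq : P = _ := eq_span_X_of_le_of_le_height hPle hht
  -- P is now m, and an element of the irrelevant ideal has no constant term, so P contains that
  -- ideal.
  refine p.not_irrelevant_le fun g hg ↦ ?_
  change g ∈ P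
  rw [heq]
  by_contra hgm
  refine coeff_zero_ne_zero_of_notMem_span_X hgm ?_
  have h0 : weightedHomogeneousComponent b 0 g = 0 := by
    rw [← weightedDecomposition.decompose'_apply]
    exact (HomogeneousIdeal.mem_irrelevant_iff _ g).1 hg
  simpa [coeff_weightedHomogeneousComponent] using congrArg (coeff 0) h0

end

open Classical in
theorem mainTheorem1 (n : ℕ) (a b : Fin n → ℕ)
    (ha : ∀ i, 0 < a i) (hb : ∀ i, 0 < b i) :
    List.TFAE [
      ∃ f : Fin n → MvPolynomial (Fin n) ℂ, IsHomogeneousRegularSequence a b f,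
      IsWeightedCompleteIntersection a b ∅,
      ∀ I : Finset (Fin n),
        I.card ≤ (Multiset.filter (fun s => s ∈ numericalSemigroup (b '' (I : Set (Fin n))))
          (Multiset.map a Finset.univ.val)).card] := by
  have hcard (I : Finset (Fin n)) :
      (Multiset.filter (fun s => s ∈ numericalSemigroup (b '' (I : Set (Fin n))))
        (Multiset.map a Finset.univ.val)).card =
      (Finset.univ.filter fun j ↦
        a j ∈ AddSubmonoid.closure (b '' (I : Set (Fin n)))).card := by
    rw [Multiset.filter_map, Multiset.card_map]
    rfl
  tfae_have 1 → 2 := fun ⟨f, hf⟩ ↦ ⟨f, hf, (hf.zeroLocus_eq_empty hb).symm⟩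
  tfae_have 2 → 1 := fun ⟨f, hf, _⟩ ↦ ⟨f, hf⟩
  tfae_have 1 → 3 := by
    rintro ⟨f, hf⟩ I
    rw [hcard]
    exact MvPolynomial.card_le_card_filter_mem_closure hf.homogeneous
      (fun j ↦ (hf.homogeneous j).mem_span_X (ha j)) hf.regular.toIsWeaklyRegular I
  tfae_have 3 → 1 := by
    intro h
    refine exists_isHomogeneousRegularSequence ha hb fun s ↦ ?_
    have := h s.toFinset
    rw [hcard, Set.coe_toFinset] at this
    rwa [Set.ncard_eq_toFinset_card', Set.ncard_eq_toFinset_card', Set.toFinset_ofPred]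
  tfae_finish
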